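/- Let $d\ge 1$ be an integer, $\tau\in(2,3)$ and $\lambda>0$. For a real number $n>0$, the threshold GIRG $H\sim\mathcal G(n,[0,1]^d,\tau,\lambda)$ is the following random graph. Its vertices are the points of a homogeneous Poisson point process on $[0,1]^d$ with $n$ points in expectation. Every vertex $v$ independently gets a weight $w_v$ from the Pareto distribution $\Pr[w_v\le w]=1-w^{-(\tau-1)}$ ($w\ge 1$). Two distinct vertices $u,v$ are adjacent if and only if their $L_\infty$-distance is at most $(\lambda w_uw_v/n)^{1/d}$. Then for every $m_0>0$ there are constants $c,C,\kappa>0$, depending only on $d,\tau,\lambda,m_0$, such that the following holds for every function $f$, every $n>0$ with $f(n)\ge m_0$, and every axis-parallel cube (cell) $Q\subseteq[0,1]^d$ of side length $\Delta=(f(n)/n)^{1/d}$. The subgraph $G$ of $H$ induced by the vertices in $Q$ satisfies $$\Pr\bigl[G\text{ has a connected component with at least } c\,f(n)\text{ and at most } C\,f(n)\text{ vertices}\bigr]\;\ge\;1-\exp\bigl(-\kappa\, f(n)^{(3-\tau)/2}\bigr).$$ In other words, if $f(n)$ is bounded away from $0$, then $G$ has a connected component of size $\Theta(f(n))$ with probability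 $1-\exp(-\Omega(f(n)^{(3-\tau)/2}))$. -/

import Mathlib

open MeasureTheory ProbabilityTheory

noncomputable section

namespace GIRG

/-- A marked point: a position in `ℝ^d` (with the sup metric, that is the `L_∞` metric)
together with a weight. -/
abbrev MarkedPoint (d : ℕ) : Type := (Fin d → ℝ) × ℝ

/-- The ground space `[0,1]^d`. -/
def box (d : ℕ) : Set (Fin d → ℝ) := Set.Icc 0 1

/-- The axis-parallel cube (cell) `∏ᵢ [aᵢ, aᵢ + Δ]` of side length `Δ` with lower corner `a`. -/
def cell {d : ℕ} (a : Fin d → ℝ) (Δ : ℝ) : Set (Fin d → ℝ) := Set.Icc a (fun i => a i + Δ)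

/-- Law of a single vertex: uniform position in `[0,1]^d` and, independently, a weight with
the Pareto distribution on `[1,∞)` of density `(τ - 1) w^(-τ)`, so that
`P(weight ≤ w) = 1 - w^(-(τ - 1))`. -/
def vertexLaw (d : ℕ) (τ : ℝ) : Measure (MarkedPoint d) :=
  (volume.restrict (box d)).prod (paretoMeasure 1 (τ - 1))

/-- Sample space of the marked Poisson point process: the number `N` of points, and a sequence
of marked points of which the first `N` are used. -/
abbrev Sample (d : ℕ) : Type := ℕ × (ℕ → MarkedPoint d)

/-- Law of the marked homogeneous Poisson point process on `[0,1]^d` with `n` points in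
expectation: the number of points is Poisson with mean `n` and, independently of it, the marked
points are i.i.d. with law `vertexLaw d τ`. -/
def law (d : ℕ) (τ n : ℝ) : Measure (Sample d) :=
  (poissonMeasure n.toNNReal).prod (Measure.infinitePi fun _ : ℕ => vertexLaw d τ)

/-- The position of the `i`-th vertex. -/
def pos {d : ℕ} (ω : Sample d) (i : Fin ω.1) : Fin d → ℝ := (ω.2 i).1

/-- The weight of the `i`-th vertex. -/
def weight {d : ℕ} (ω : Sample d) (i : Fin ω.1) : ℝ := (ω.2 i).2

/-- The threshold GIRG on the sampled vertices: distinct vertices `u`, `v` are adjacent iff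
`dist(u,v) ≤ (lam * w_u * w_v / n)^(1/d)`. -/
def thresholdGraph {d : ℕ} (lam n : ℝ) (ω : Sample d) : SimpleGraph (Fin ω.1) where
  Adj u v := u ≠ v ∧
    dist (pos ω u) (pos ω v) ≤ (lam * weight ω u * weight ω v / n) ^ (1 / (d : ℝ))
  symm := ⟨fun u v h => ⟨h.1.symm, by
    rw [dist_comm, mul_right_comm]
    exact h.2⟩⟩
  loopless := ⟨fun _ h => h.1 rfl⟩

/-- The subgraph of the threshold GIRG induced by the vertices with position in `C`. -/
def inducedIn {d : ℕ} (lam n : ℝ) (ω : Sample d) (C : Set (Fin d → ℝ)) :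
    SimpleGraph {i : Fin ω.1 | pos ω i ∈ C} :=
  (thresholdGraph lam n ω).induce {i : Fin ω.1 | pos ω i ∈ C}

/-- `G` has a connected component whose number of vertices lies in `[l, u]`. -/
def HasComponentOfSize {V : Type*} (G : SimpleGraph V) (l u : ℝ) : Prop :=
  ∃ K : G.ConnectedComponent, l ≤ (K.supp.ncard : ℝ) ∧ (K.supp.ncard : ℝ) ≤ u

theorem isProbabilityMeasure_vertexLaw (d : ℕ) {τ : ℝ} (hτ : 1 < τ) :
    IsProbabilityMeasure (vertexLaw d τ) := by
  have h1 : IsProbabilityMeasure (paretoMeasure 1 (τ - 1)) :=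
    isProbabilityMeasure_paretoMeasure one_pos (by linarith)
  have h2 : IsProbabilityMeasure ((volume : Measure (Fin d → ℝ)).restrict (box d)) :=
    ⟨by simp [box, Real.volume_Icc_pi]⟩
  unfold vertexLaw
  infer_instance

theorem isProbabilityMeasure_law (d : ℕ) {τ : ℝ} (hτ : 1 < τ) (n : ℝ) :
    IsProbabilityMeasure (law d τ n) := by
  have := isProbabilityMeasure_vertexLaw d hτ
  unfold law
  infer_instance

end GIRG

end

/-! Write `F = f n` and split the cell dyadically. A subcell of depth `k` has rescaled volume `V = F
/ (2 ^ d) ^ k`; its hubs are its points of weight about `√(V / lam)`. Such weights make every hub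
adjacent to every hub of the parent subcell. The expected number of hubs is at least of order `V · V
^ (-(τ - 1) / 2) = V ^ ((3 - τ) / 2)`, so large subcells rarely lack one. Subdivision stops at depth
`K`, where `V` is a constant up to a factor `2 ^ d`.

If the hubless subcells have total volume (the defect) below `F / 2`, more than half of the deepest
subcells have a hub in every ancestor, themselves included. Chains of hubs join them all to one root
hub, which gives a component of order `(2 ^ d) ^ K`, hence of order `F`
(`hasComponentOfSize_of_defect_lt`).

Hub sets of different subcells are disjoint, so their void events are independent and the
exponential moment of the defect factorises. Markov's inequality with tilt `θ` of order `F ^ ((3 -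
τ) / 2 - 1)` gives the rate (`law_le_defect_le`). The upper bound on the size is a Chernoff bound
for all points of the cell. For bounded `F`, a single vertex suffices as a component. -/

noncomputable section
namespace GIRG
open scoped ENNReal NNReal

/-! ### Poisson process: Laplace functional, void events, counts -/

/-- The probability generating function of the Poisson distribution. -/
theorem lintegral_pow_poissonMeasure (r q : ℝ≥0) :
    ∫⁻ N, (q : ℝ≥0∞) ^ N ∂(poissonMeasure r) = ENNReal.ofReal (Real.exp (r * (q - 1))) := by
  have key : HasSum (fun N : ℕ => Real.exp (-r) * (r : ℝ) ^ N / N.factorial * (q : ℝ) ^ N)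
      (Real.exp (r * (q - 1))) := by
    have h := (NormedSpace.expSeries_div_hasSum_exp ((r : ℝ) * q)).mul_left (Real.exp (-r))
    rw [← Real.exp_eq_exp_ℝ, ← Real.exp_add] at h
    have h1 : -(r : ℝ) + r * q = r * (q - 1) := by ring
    rw [h1] at h
    refine h.congr_fun fun N => ?_
    rw [mul_pow]; ring
  rw [lintegral_countable']
  simp_rw [poissonMeasure_singleton]
  rw [← key.tsum_eq, ENNReal.ofReal_tsum_of_nonneg (fun N => by positivity) key.summable]
  refine tsum_congr fun N => ?_
  rw [ENNReal.ofReal_mul (by positivity), ENNReal.ofReal_pow (by positivity),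
    ENNReal.ofReal_coe_nnreal, mul_comm]

variable {M : Type*} [MeasurableSpace M]

theorem lintegral_prod_range_infinitePi (μ : Measure M) [IsProbabilityMeasure μ]
    {g : M → ℝ≥0∞} (hg : Measurable g) (N : ℕ) :
    ∫⁻ x, ∏ i ∈ Finset.range N, g (x i) ∂(Measure.infinitePi fun _ : ℕ => μ)
      = (∫⁻ y, g y ∂μ) ^ N := by
  have hind : iIndepFun (fun (i : ℕ) (x : ℕ → M) => x i) (Measure.infinitePi fun _ : ℕ => μ) :=
    iIndepFun_infinitePi (X := fun _ => id) (fun _ => measurable_id)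
  have hprod := lintegral_prod_eq_prod_lintegral_of_indepFun (Finset.range N)
    (fun i (x : ℕ → M) => g (x i)) (hind.comp (fun _ => g) fun _ => hg)
    fun i => hg.comp (measurable_pi_apply i)
  rw [hprod]
  have : ∀ i : ℕ, ∫⁻ x, g (x i) ∂(Measure.infinitePi fun _ : ℕ => μ) = ∫⁻ y, g y ∂μ := fun i => by
    have h := (measurePreserving_eval_infinitePi (fun _ : ℕ => μ) i)
    exact h.lintegral_comp hg
  simp [this]

theorem measurable_prod_range {g : M → ℝ≥0∞} (hg : Measurable g) :
    Measurable fun ω : ℕ × (ℕ → M) => ∏ i ∈ Finset.range ω.1, g (ω.2 i) :=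
  measurable_from_prod_countable_right fun N =>
    Finset.measurable_fun_prod (Finset.range N) (f := fun i (x : ℕ → M) => g (x i))
      fun i _ => hg.comp (measurable_pi_apply i)

/-- The Laplace functional of a Poisson point process, in multiplicative form. -/
theorem lintegral_prod_poisson (μ : Measure M) [IsProbabilityMeasure μ] (r : ℝ≥0)
    {g : M → ℝ≥0∞} (hg : Measurable g) {q : ℝ≥0} (hq : ∫⁻ y, g y ∂μ = q) :
    ∫⁻ ω, ∏ i ∈ Finset.range ω.1, g (ω.2 i)
        ∂((poissonMeasure r).prod (Measure.infinitePi fun _ : ℕ => μ))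
      = ENNReal.ofReal (Real.exp (r * (q - 1))) := by
  rw [lintegral_prod _ (measurable_prod_range hg).aemeasurable]
  simp_rw [lintegral_prod_range_infinitePi μ hg, hq]
  exact lintegral_pow_poissonMeasure r q

/-- The event that none of the first `N` points lies in `A`. -/
def void (A : Set M) : Set (ℕ × (ℕ → M)) := {ω | ∀ i < ω.1, ω.2 i ∉ A}

/-- A product over the points is the form to which the Laplace functional applies. -/
theorem indicator_void {M : Type*} (A : Set M) (ω : ℕ × (ℕ → M)) :
    (void A).indicator (1 : ℕ × (ℕ → M) → ℝ≥0∞) ω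
      = ∏ i ∈ Finset.range ω.1, Aᶜ.indicator (1 : M → ℝ≥0∞) (ω.2 i) := by
  by_cases h : ω ∈ void A
  · rw [Set.indicator_of_mem h, Finset.prod_eq_one]
    · rfl
    · intro i hi
      exact Set.indicator_of_mem (h i (Finset.mem_range.1 hi)) _
  · rw [Set.indicator_of_notMem h]
    simp only [void, Set.mem_ofPred_eq, not_forall, not_not] at h
    obtain ⟨i, hi, hA⟩ := h
    refine (Finset.prod_eq_zero (Finset.mem_range.2 hi) ?_).symm
    exact Set.indicator_of_notMem (by simpa using hA) _

theorem measurableSet_void {A : Set M} (hA : MeasurableSet A) : MeasurableSet (void A) := by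
  have h : Measurable ((void A).indicator (1 : ℕ × (ℕ → M) → ℝ≥0∞)) := by
    have := measurable_prod_range (M := M) (measurable_one.indicator hA.compl)
    convert! this using 1
    exact funext (indicator_void A)
  exact (measurable_indicator_const_iff (1 : ℝ≥0∞)).1 h

theorem measure_void (μ : Measure M) [IsProbabilityMeasure μ] (r : ℝ≥0)
    {A : Set M} (hA : MeasurableSet A) :
    ((poissonMeasure r).prod (Measure.infinitePi fun _ : ℕ => μ)) (void A)
      = ENNReal.ofReal (Real.exp (-(r * μ.real A))) := by
  rw [← lintegral_indicator_one (measurableSet_void hA)]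
  simp_rw [indicator_void A]
  have hq : ∫⁻ y, Aᶜ.indicator (1 : M → ℝ≥0∞) y ∂μ = (μ Aᶜ).toNNReal := by
    rw [lintegral_indicator_one hA.compl, ENNReal.coe_toNNReal (measure_ne_top _ _)]
  rw [lintegral_prod_poisson μ r (measurable_one.indicator hA.compl) hq]
  have : (((μ Aᶜ).toNNReal : ℝ≥0) : ℝ) = 1 - μ.real A := by
    rw [← probReal_compl_eq_one_sub hA]; rfl
  rw [this]
  congr 2
  ring

theorem void_biUnion {M ι : Type*} (A : ι → Set M) (t : Finset ι) (ω : ℕ × (ℕ → M)) :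
    ω ∈ void (⋃ i ∈ t, A i) ↔ ∀ i ∈ t, ω ∈ void (A i) := by
  simp only [void, Set.mem_ofPred_eq, Set.mem_iUnion, not_exists]
  exact ⟨fun h i hi k hk => h k hk i hi, fun h k hk i hi => h i hi k hk⟩

/-- Void events of disjoint sets are independent, in the form of a generating function. -/
theorem lintegral_prod_one_add_void (μ : Measure M) [IsProbabilityMeasure μ] (r : ℝ≥0)
    {ι : Type*} (S : Finset ι) (A : ι → Set M) (hA : ∀ i ∈ S, MeasurableSet (A i))
    (hdisj : (S : Set ι).PairwiseDisjoint A) (x : ι → ℝ≥0∞) :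
    ∫⁻ ω, ∏ i ∈ S, (1 + x i * (void (A i)).indicator 1 ω)
        ∂((poissonMeasure r).prod (Measure.infinitePi fun _ : ℕ => μ))
      = ∏ i ∈ S, (1 + x i * ENNReal.ofReal (Real.exp (-(r * μ.real (A i))))) := by
  classical
  -- Expand over subsets `t`: the void indicators multiply to that of a union, and additivity of `μ`
  -- on disjoint sets factors its probability again.
  simp_rw [Finset.prod_one_add]
  have hU : ∀ t ∈ S.powerset, MeasurableSet (⋃ i ∈ t, A i) := fun t ht =>
    Finset.measurableSet_biUnion t fun i hi => hA i (Finset.mem_powerset.1 ht hi)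
  have hprod : ∀ (t : Finset ι) (ω : ℕ × (ℕ → M)),
      ∏ i ∈ t, x i * (void (A i)).indicator 1 ω
        = (∏ i ∈ t, x i) * (void (⋃ i ∈ t, A i)).indicator 1 ω := by
    intro t ω
    rw [Finset.prod_mul_distrib]
    congr 1
    by_cases h : ω ∈ void (⋃ i ∈ t, A i)
    · rw [Set.indicator_of_mem h]
      refine Finset.prod_eq_one fun i hi => ?_
      rw [Set.indicator_of_mem ((void_biUnion A t ω).1 h i hi)]; rfl
    · rw [Set.indicator_of_notMem h]
      rw [void_biUnion] at h
      push Not at h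
      obtain ⟨i, hi, h⟩ := h
      exact Finset.prod_eq_zero hi (Set.indicator_of_notMem h _)
  simp_rw [hprod]
  rw [lintegral_finsetSum' _ fun t ht => ((measurable_one.indicator
    (measurableSet_void (hU t ht))).const_mul _).aemeasurable]
  refine Finset.sum_congr rfl fun t ht => ?_
  rw [lintegral_const_mul _ (measurable_one.indicator (measurableSet_void (hU t ht))),
    lintegral_indicator_one (measurableSet_void (hU t ht)), measure_void μ r (hU t ht),
    Finset.prod_mul_distrib]
  congr 1
  have hsub := Finset.mem_powerset.1 ht
  rw [← ENNReal.ofReal_prod_of_nonneg fun i _ => (Real.exp_pos _).le, ← Real.exp_sum,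
    measureReal_biUnion_finset (fun i hi j hj hij => hdisj (hsub hi) (hsub hj) hij)
      fun i hi => hA i (hsub hi), Finset.mul_sum, Finset.sum_neg_distrib]

open Classical in
/-- The number of points of the process in `A`. -/
def count (A : Set M) (ω : ℕ × (ℕ → M)) : ℕ := ((Finset.range ω.1).filter fun i => ω.2 i ∈ A).card

/-- A Chernoff bound for the number of points in a set. -/
theorem measure_lt_count_le (μ : Measure M) [IsProbabilityMeasure μ] (r : ℝ≥0)
    {A : Set M} (hA : MeasurableSet A) (b : ℝ) :
    ((poissonMeasure r).prod (Measure.infinitePi fun _ : ℕ => μ)) {ω | b < count A ω}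
      ≤ ENNReal.ofReal (Real.exp (2 * (r * μ.real A) - b)) := by
  classical
  set P := (poissonMeasure r).prod (Measure.infinitePi fun _ : ℕ => μ)
  -- Each point in `A` contributes a factor `exp 1`; the 2 in the bound comes from `exp 1 - 1 ≤ 2`.
  let e : ℝ≥0 := ⟨Real.exp 1, (Real.exp_pos 1).le⟩
  let g : M → ℝ≥0∞ := fun y => if y ∈ A then e else 1
  have hg : Measurable g := Measurable.ite hA measurable_const measurable_const
  have hint : ∫⁻ y, g y ∂μ = (e * (μ A).toNNReal + (μ Aᶜ).toNNReal : ℝ≥0) := by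
    rw [← lintegral_add_compl g hA,
      setLIntegral_congr_fun (g := fun _ => (e : ℝ≥0∞)) hA fun y hy => if_pos hy,
      setLIntegral_congr_fun (g := fun _ => (1 : ℝ≥0∞)) hA.compl fun y hy => if_neg hy]
    simp
  have hcount : ∀ ω : ℕ × (ℕ → M), ∏ i ∈ Finset.range ω.1, g (ω.2 i)
      = ENNReal.ofReal (Real.exp (count A ω)) := by
    intro ω
    have : (e : ℝ≥0∞) = ENNReal.ofReal (Real.exp 1) :=
      (ENNReal.ofReal_eq_coe_nnreal (Real.exp_pos 1).le).symm
    simp only [g, count, Finset.prod_ite, Finset.prod_const, this]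
    rw [← ENNReal.ofReal_pow (Real.exp_pos 1).le, ← Real.exp_nat_mul]
    simp
  have hm := mul_meas_ge_le_lintegral (μ := P) (measurable_prod_range hg)
    (ENNReal.ofReal (Real.exp b))
  rw [lintegral_prod_poisson μ r hg hint] at hm
  have hsub : {ω : ℕ × (ℕ → M) | b < count A ω} ⊆
      {ω | ENNReal.ofReal (Real.exp b) ≤ ∏ i ∈ Finset.range ω.1, g (ω.2 i)} := by
    intro ω hω
    rw [Set.mem_ofPred_eq, hcount]
    exact ENNReal.ofReal_le_ofReal (Real.exp_le_exp.2 (le_of_lt hω))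
  have hAc : (((μ Aᶜ).toNNReal : ℝ≥0) : ℝ) = 1 - μ.real A := by
    rw [← probReal_compl_eq_one_sub hA]; rfl
  have hAr : (((μ A).toNNReal : ℝ≥0) : ℝ) = μ.real A := rfl
  have hb0 : ENNReal.ofReal (Real.exp b) ≠ 0 := by simpa using Real.exp_pos b
  calc P {ω | b < count A ω}
      ≤ P {ω | ENNReal.ofReal (Real.exp b) ≤ ∏ i ∈ Finset.range ω.1, g (ω.2 i)} :=
        measure_mono hsub
    _ ≤ ENNReal.ofReal (Real.exp (r * ((e * (μ A).toNNReal + (μ Aᶜ).toNNReal : ℝ≥0) - 1)))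
        / ENNReal.ofReal (Real.exp b) := by
        rw [ENNReal.le_div_iff_mul_le (Or.inl hb0) (Or.inl ENNReal.ofReal_ne_top), mul_comm]
        exact hm
    _ ≤ _ := by
        rw [← ENNReal.ofReal_div_of_pos (Real.exp_pos b), ← Real.exp_sub]
        refine ENNReal.ofReal_le_ofReal (Real.exp_le_exp.2 ?_)
        rw [NNReal.coe_add, NNReal.coe_mul, hAc, hAr]
        have he : (e : ℝ) ≤ 3 := Real.exp_one_lt_three.le
        have h0 : 0 ≤ (r : ℝ) * μ.real A := by positivity
        nlinarith

/-! ### Dyadic subcells -/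

/-- The half-open dyadic subcell at depth `k` with index `j` of the cube with corner `a` and
side length `Δ`. -/
def subcell {d : ℕ} (a : Fin d → ℝ) (Δ : ℝ) (k : ℕ) (j : Fin d → ℕ) : Set (Fin d → ℝ) :=
  Set.univ.pi fun i => Set.Ico (a i + Δ / 2 ^ k * j i) (a i + Δ / 2 ^ k * (j i + 1))

/-- The indices of the dyadic subcells at depth `k`. -/
def indices (d k : ℕ) : Finset (Fin d → ℕ) := Fintype.piFinset fun _ => Finset.range (2 ^ k)

/-- The index at depth `k` of the ancestor of the subcell `J` at depth `K`. -/
def ancestor {d : ℕ} (K k : ℕ) (J : Fin d → ℕ) : Fin d → ℕ := fun i => J i / 2 ^ (K - k)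

theorem card_indices (d k : ℕ) : (indices d k).card = (2 ^ d) ^ k := by
  simp [indices, ← pow_mul, mul_comm]

theorem mem_indices {d k : ℕ} {j : Fin d → ℕ} : j ∈ indices d k ↔ ∀ i, j i < 2 ^ k := by
  simp [indices]

theorem ancestor_mem_indices {d K k : ℕ} (hk : k ≤ K) {J : Fin d → ℕ} (hJ : J ∈ indices d K) :
    ancestor K k J ∈ indices d k := by
  rw [mem_indices] at hJ ⊢
  intro i
  rw [ancestor, Nat.div_lt_iff_lt_mul (by positivity), ← pow_add, Nat.add_sub_cancel' hk]
  exact hJ i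

theorem card_filter_ancestor_le {d K k : ℕ} (j : Fin d → ℕ) :
    ((indices d K).filter fun J => ancestor K k J = j).card ≤ (2 ^ d) ^ (K - k) := by
  have hsub : ((indices d K).filter fun J => ancestor K k J = j) ⊆
      Fintype.piFinset fun i => Finset.Ico (j i * 2 ^ (K - k)) ((j i + 1) * 2 ^ (K - k)) := by
    intro J hJ
    rw [Finset.mem_filter] at hJ
    rw [Fintype.mem_piFinset]
    intro i
    rw [Finset.mem_Ico]
    have h : J i / 2 ^ (K - k) = j i := congrFun hJ.2 i
    rw [← h, mul_comm _ (2 ^ (K - k)), mul_comm _ (2 ^ (K - k))]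
    exact ⟨Nat.mul_div_le _ _, Nat.lt_mul_div_succ _ (by positivity)⟩
  refine (Finset.card_le_card hsub).trans ?_
  simp [← Nat.sub_mul, ← pow_mul, mul_comm]

theorem measurableSet_subcell {d : ℕ} (a : Fin d → ℝ) (Δ : ℝ) (k : ℕ) (j : Fin d → ℕ) :
    MeasurableSet (subcell a Δ k j) :=
  MeasurableSet.univ_pi fun _ => measurableSet_Ico

theorem volume_real_subcell {d : ℕ} (a : Fin d → ℝ) {Δ : ℝ} (hΔ : 0 ≤ Δ) (k : ℕ)
    (j : Fin d → ℕ) : volume.real (subcell a Δ k j) = (Δ / 2 ^ k) ^ d := by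
  have h : ∀ i, a i + Δ / 2 ^ k * ((j i : ℝ) + 1) - (a i + Δ / 2 ^ k * j i) = Δ / 2 ^ k :=
    fun i => by ring
  rw [subcell, measureReal_def, Real.volume_pi_Ico_toReal]
  · simp [h, div_pow]
  · intro i
    have : 0 ≤ Δ / 2 ^ k := by positivity
    simp only
    nlinarith

theorem disjoint_subcell {d : ℕ} (a : Fin d → ℝ) {Δ : ℝ} (hΔ : 0 ≤ Δ) (k : ℕ)
    {j j' : Fin d → ℕ} (hj : j ≠ j') : Disjoint (subcell a Δ k j) (subcell a Δ k j') := by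
  have key : ∀ (x : Fin d → ℝ) (p q : Fin d → ℕ) (i : Fin d), x ∈ subcell a Δ k p →
      x ∈ subcell a Δ k q → ¬ p i < q i := by
    intro x p q i hp hq hlt
    have h1 := (hp i trivial).2
    have h2 := (hq i trivial).1
    have h3 : (p i : ℝ) + 1 ≤ q i := by exact_mod_cast hlt
    have : Δ / 2 ^ k * ((p i : ℝ) + 1) ≤ Δ / 2 ^ k * q i := by gcongr
    linarith
  rw [Set.disjoint_left]
  intro x hx hx'
  refine hj (funext fun i => ?_)
  exact le_antisymm (not_lt.1 (key x j' j i hx' hx)) (not_lt.1 (key x j j' i hx hx'))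

theorem subcell_subset_cell {d : ℕ} (a : Fin d → ℝ) {Δ : ℝ} (hΔ : 0 ≤ Δ) {k : ℕ}
    {j : Fin d → ℕ} (hj : j ∈ indices d k) : subcell a Δ k j ⊆ cell a Δ := by
  intro x hx
  rw [mem_indices] at hj
  refine ⟨fun i => ?_, fun i => ?_⟩
  · have := (hx i trivial).1
    have : 0 ≤ Δ / 2 ^ k * j i := by positivity
    linarith
  · have h1 := (hx i trivial).2
    have h2 : (j i : ℝ) + 1 ≤ 2 ^ k := by exact_mod_cast hj i
    have h3 : Δ / 2 ^ k * ((j i : ℝ) + 1) ≤ Δ / 2 ^ k * 2 ^ k := by gcongr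
    have h4 : Δ / 2 ^ k * 2 ^ k = Δ := by field_simp
    simp only
    linarith

theorem subcell_succ_subset {d : ℕ} (a : Fin d → ℝ) {Δ : ℝ} (hΔ : 0 ≤ Δ) (k : ℕ)
    (j : Fin d → ℕ) : subcell a Δ (k + 1) j ⊆ subcell a Δ k fun i => j i / 2 := by
  intro x hx i _
  have h1 := (hx i trivial).1
  have h2 := (hx i trivial).2
  have h3 : (2 * (j i / 2 : ℕ) : ℝ) ≤ j i := by exact_mod_cast Nat.mul_div_le (j i) 2
  have h4 : (j i : ℝ) + 1 ≤ 2 * ((j i / 2 : ℕ) + 1) := by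
    have : j i + 1 ≤ 2 * (j i / 2 + 1) := by omega
    exact_mod_cast this
  have e : Δ / 2 ^ (k + 1) = Δ / 2 ^ k / 2 := by rw [pow_succ]; field_simp
  rw [e] at h1 h2
  have h5 : 0 ≤ Δ / 2 ^ k / 2 := by positivity
  have h6 := mul_le_mul_of_nonneg_left h3 h5
  have h7 := mul_le_mul_of_nonneg_left h4 h5
  constructor <;> simp only at * <;> linarith

theorem dist_le_of_mem_subcell {d : ℕ} {a : Fin d → ℝ} {Δ : ℝ} (hΔ : 0 ≤ Δ) {k : ℕ}
    {j : Fin d → ℕ} {x y : Fin d → ℝ} (hx : x ∈ subcell a Δ k j) (hy : y ∈ subcell a Δ k j) :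
    dist x y ≤ Δ / 2 ^ k := by
  rw [dist_pi_le_iff (by positivity)]
  intro i
  have h1 := hx i trivial
  have h2 := hy i trivial
  simp only [Set.mem_Ico] at h1 h2
  rw [Real.dist_eq, abs_le]
  constructor <;> linarith

theorem ancestor_succ {d K k : ℕ} (hk : k + 1 ≤ K) (J : Fin d → ℕ) :
    ancestor K k J = fun i => ancestor K (k + 1) J i / 2 := by
  funext i
  have : K - k = K - (k + 1) + 1 := by omega
  rw [ancestor, ancestor, Nat.div_div_eq_div_mul, this, pow_succ]

theorem ancestor_self {d K : ℕ} (J : Fin d → ℕ) : ancestor K K J = J := by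
  funext i
  simp [ancestor]

theorem ancestor_zero {d K : ℕ} {J : Fin d → ℕ} (hJ : J ∈ indices d K) :
    ancestor K 0 J = 0 := by
  funext i
  exact Nat.div_eq_of_lt (mem_indices.1 hJ i)

/-! ### Hubs and their adjacency -/

/-- The weight at which two vertices in a cube of rescaled volume `V / 2 ^ d` and in its parent
are certain to be adjacent. -/
def hubWeight (d : ℕ) (lam V : ℝ) : ℝ := Real.sqrt (2 ^ d * V / lam)

/-- The marked points in a dyadic subcell at depth `k` of a cube of rescaled volume `F`, whose
weight lies in the range of hubs of that depth. -/
def hubs {d : ℕ} (lam F : ℝ) (a : Fin d → ℝ) (Δ : ℝ) (p : (_ : ℕ) × (Fin d → ℕ)) :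
    Set (MarkedPoint d) :=
  subcell a Δ p.1 p.2 ×ˢ
    Set.Ico (hubWeight d lam (F / (2 ^ d) ^ p.1)) (hubWeight d lam (2 ^ d * (F / (2 ^ d) ^ p.1)))

/-- The indices of all dyadic subcells of depth at most `K`. -/
def tree (d K : ℕ) : Finset ((_ : ℕ) × (Fin d → ℕ)) :=
  (Finset.range (K + 1)).sigma fun k => indices d k

theorem hubWeight_mono {d : ℕ} {lam : ℝ} (hlam : 0 < lam) {V V' : ℝ} (h : V ≤ V') :
    hubWeight d lam V ≤ hubWeight d lam V' := by
  unfold hubWeight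
  gcongr

theorem measurableSet_hubs {d : ℕ} (lam F : ℝ) (a : Fin d → ℝ) (Δ : ℝ)
    (p : (_ : ℕ) × (Fin d → ℕ)) : MeasurableSet (hubs lam F a Δ p) :=
  (measurableSet_subcell a Δ p.1 p.2).prod measurableSet_Ico

/-- At equal depth the positions separate; at different depths the weights do, since one level down
divides the volume by `2 ^ d` and the half-open ranges abut. This is the source of independence. -/
theorem pairwise_disjoint_hubs {d : ℕ} {lam F : ℝ} (hlam : 0 < lam) (hF : 0 ≤ F)
    (a : Fin d → ℝ) {Δ : ℝ} (hΔ : 0 ≤ Δ) : Pairwise (Function.onFun Disjoint (hubs lam F a Δ)) := by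
  have key : ∀ k k' : ℕ, k < k' → hubWeight d lam (2 ^ d * (F / (2 ^ d) ^ k'))
      ≤ hubWeight d lam (F / (2 ^ d) ^ k) := by
    intro k k' h
    refine hubWeight_mono hlam ?_
    obtain ⟨m, rfl⟩ := Nat.exists_eq_add_of_lt h
    have e : (2 : ℝ) ^ d * (F / (2 ^ d) ^ (k + m + 1)) = F / (2 ^ d) ^ k / (2 ^ d) ^ m := by
      rw [pow_succ, pow_add]; field_simp
    rw [e]
    exact div_le_self (by positivity) (one_le_pow₀ (one_le_pow₀ one_le_two))
  rintro ⟨k, j⟩ ⟨k', j'⟩ hne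
  rw [Function.onFun, Set.disjoint_left]
  rintro ⟨x, w⟩ ⟨hx, hw⟩ ⟨hx', hw'⟩
  simp only [Set.mem_Ico] at hx hx' hw hw'
  rcases lt_trichotomy k k' with h | h | h
  · have := key k k' h; linarith
  · subst h
    exact Set.disjoint_left.1 (disjoint_subcell a hΔ k fun h => hne (by rw [h])) hx hx'
  · have := key k' k h; linarith

/-- Both weights are at least `√(V / lam)`: the factor `2 ^ d` in `hubWeight` offsets the smaller
volume of the child. -/
theorem le_mul_hubWeight {d : ℕ} {lam V w w' : ℝ} (hlam : 0 < lam) (hV : 0 ≤ V)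
    (hw : hubWeight d lam V ≤ w) (hw' : hubWeight d lam (V / 2 ^ d) ≤ w') :
    V ≤ lam * w * w' := by
  have h1 : Real.sqrt (V / lam) ≤ w := by
    refine le_trans (Real.sqrt_le_sqrt ?_) hw
    gcongr
    exact le_mul_of_one_le_left hV (one_le_pow₀ one_le_two)
  have h2 : Real.sqrt (V / lam) ≤ w' := by
    refine le_trans (Real.sqrt_le_sqrt ?_) hw'
    apply le_of_eq
    field_simp
  have h3 : Real.sqrt (V / lam) * Real.sqrt (V / lam) = V / lam :=
    Real.mul_self_sqrt (by positivity)
  have h4 : V / lam ≤ w * w' :=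
    h3 ▸ mul_le_mul h1 h2 (Real.sqrt_nonneg _) ((Real.sqrt_nonneg _).trans h1)
  rw [div_le_iff₀ hlam] at h4
  linarith

/-- Both points lie in the parent subcell, whose side is `(V / n) ^ (1 / d)` for its rescaled volume
`V`. -/
theorem adj_of_mem_hubs {d : ℕ} (hd : 1 ≤ d) {lam n F : ℝ} (hlam : 0 < lam) (hn : 0 < n)
    (hF : 0 < F) {a : Fin d → ℝ} {k : ℕ} {j : Fin d → ℕ} {x y : MarkedPoint d}
    (hx : x ∈ hubs lam F a ((F / n) ^ (1 / (d : ℝ))) ⟨k, fun i => j i / 2⟩)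
    (hy : y ∈ hubs lam F a ((F / n) ^ (1 / (d : ℝ))) ⟨k + 1, j⟩) :
    dist y.1 x.1 ≤ (lam * y.2 * x.2 / n) ^ (1 / (d : ℝ)) := by
  have hΔ : 0 ≤ (F / n) ^ (1 / (d : ℝ)) := by positivity
  refine (dist_le_of_mem_subcell hΔ (subcell_succ_subset a hΔ k j hy.1) hx.1).trans ?_
  have h := le_mul_hubWeight hlam (V := F / (2 ^ d) ^ k) (by positivity) hx.2.1 (w' := y.2)
    (le_of_eq_of_le (by rw [pow_succ, div_div]) hy.2.1)
  have e : (F / n) ^ (1 / (d : ℝ)) / 2 ^ k = (F / (2 ^ d) ^ k / n) ^ (1 / (d : ℝ)) := by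
    have h2 : ((2 : ℝ) ^ k) = (((2 : ℝ) ^ k) ^ d) ^ (1 / (d : ℝ)) := by
      rw [one_div, Real.pow_rpow_inv_natCast (by positivity) (by omega)]
    conv_lhs => rw [h2]
    rw [← Real.div_rpow (by positivity) (by positivity), ← pow_mul, ← pow_mul, mul_comm d k,
      div_right_comm]
  rw [e]
  gcongr
  linarith

/-! ### From a small defect to a large component -/

/-- The total rescaled volume of the dyadic subcells of depth at most `K` without hubs. -/
def defect {d : ℕ} (lam F : ℝ) (a : Fin d → ℝ) (Δ : ℝ) (K : ℕ) (ω : Sample d) : ℝ :=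
  ∑ p ∈ tree d K, F / (2 ^ d) ^ p.1 * (void (hubs lam F a Δ p)).indicator 1 ω

theorem ncard_supp_le_count {d : ℕ} (lam n : ℝ) (ω : Sample d) (Q : Set (Fin d → ℝ))
    (C : (inducedIn lam n ω Q).ConnectedComponent) :
    C.supp.ncard ≤ count (Q ×ˢ Set.univ) ω := by
  classical
  have h : Set.ncard C.supp ≤ (((Finset.range ω.1).filter
      fun i => ω.2 i ∈ Q ×ˢ Set.univ : Finset ℕ) : Set ℕ).ncard := by
    refine Set.ncard_le_ncard_of_injOn (fun v => ((v : Fin ω.1) : ℕ)) ?_ ?_ (Finset.finite_toSet _)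
    · intro v _
      simp only [Finset.coe_filter, Finset.mem_range, Set.mem_ofPred_eq]
      exact ⟨v.1.2, v.2, trivial⟩
    · intro v _ v' _ h
      exact Subtype.ext (Fin.ext h)
  rw [Set.ncard_coe_finset] at h
  unfold count
  convert h

theorem hasComponentOfSize_of_notMem_void {d : ℕ} (lam n : ℝ) {ω : Sample d}
    {Q : Set (Fin d → ℝ)} (h : ω ∉ void (Q ×ˢ (Set.univ : Set ℝ))) {l u : ℝ} (hl : l ≤ 1)
    (hu : (count (Q ×ˢ Set.univ) ω : ℝ) ≤ u) :
    HasComponentOfSize (inducedIn lam n ω Q) l u := by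
  simp only [void, Set.mem_ofPred_eq, not_forall, not_not] at h
  obtain ⟨i, hi, hQ⟩ := h
  let v : {i : Fin ω.1 | pos ω i ∈ Q} := ⟨⟨i, hi⟩, hQ.1⟩
  refine ⟨(inducedIn lam n ω Q).connectedComponentMk v, hl.trans ?_,
    le_trans (by exact_mod_cast ncard_supp_le_count lam n ω Q _) hu⟩
  have : 0 < ((inducedIn lam n ω Q).connectedComponentMk v).supp.ncard :=
    (Set.ncard_pos (Set.toFinite _)).2 ⟨v, rfl⟩
  exact_mod_cast this

open Classical in
/-- The deepest subcells all of whose ancestors contain a hub. -/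
def goodIndices {d : ℕ} (lam F : ℝ) (a : Fin d → ℝ) (Δ : ℝ) (K : ℕ) (ω : Sample d) :
    Finset (Fin d → ℕ) :=
  (indices d K).filter fun J => ∀ k ≤ K, ω ∉ void (hubs lam F a Δ ⟨k, ancestor K k J⟩)

/-- A deepest subcell that is not good has a hubless ancestor. A hubless subcell of depth `k` spoils
at most `(2 ^ d) ^ (K - k)` of them, which is `(2 ^ d) ^ K / F` times its volume. -/
theorem card_indices_le {d : ℕ} {lam F : ℝ} (hF : 0 < F) (a : Fin d → ℝ) (Δ : ℝ) (K : ℕ)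
    (ω : Sample d) :
    ((2 ^ d) ^ K : ℝ) ≤ (goodIndices lam F a Δ K ω).card
      + (2 ^ d) ^ K / F * defect lam F a Δ K ω := by
  classical
  have hcover : indices d K ⊆ goodIndices lam F a Δ K ω ∪
      ((tree d K).filter fun p => ω ∈ void (hubs lam F a Δ p)).biUnion
        fun p => (indices d K).filter fun J => ancestor K p.1 J = p.2 := by
    intro J hJ
    rw [Finset.mem_union]
    by_cases hg : ∀ k ≤ K, ω ∉ void (hubs lam F a Δ ⟨k, ancestor K k J⟩)
    · exact Or.inl (by simp only [goodIndices, Finset.mem_filter]; exact ⟨hJ, hg⟩)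
    · right
      push Not at hg
      obtain ⟨k, hk, hv⟩ := hg
      rw [Finset.mem_biUnion]
      refine ⟨⟨k, ancestor K k J⟩, ?_, by simp [hJ]⟩
      rw [Finset.mem_filter]
      refine ⟨?_, hv⟩
      simp only [tree, Finset.mem_sigma, Finset.mem_range]
      exact ⟨by omega, ancestor_mem_indices hk hJ⟩
  have h1 : ((2 ^ d) ^ K : ℕ) ≤ (goodIndices lam F a Δ K ω).card
      + ∑ p ∈ (tree d K).filter (fun p => ω ∈ void (hubs lam F a Δ p)), (2 ^ d) ^ (K - p.1) := by
    rw [← card_indices]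
    refine (Finset.card_le_card hcover).trans ((Finset.card_union_le _ _).trans ?_)
    gcongr
    refine Finset.card_biUnion_le.trans (Finset.sum_le_sum fun p _ => ?_)
    exact card_filter_ancestor_le p.2
  have h2 : ((2 ^ d) ^ K / F * defect lam F a Δ K ω : ℝ) =
      ∑ p ∈ (tree d K).filter (fun p => ω ∈ void (hubs lam F a Δ p)),
        ((2 : ℝ) ^ d) ^ (K - p.1) := by
    rw [defect, Finset.mul_sum, Finset.sum_filter]
    refine Finset.sum_congr rfl fun p hp => ?_
    simp only [tree, Finset.mem_sigma, Finset.mem_range] at hp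
    split_ifs with h
    · rw [Set.indicator_of_mem h]
      have e : ((2 : ℝ) ^ d) ^ K = (2 ^ d) ^ (K - p.1) * (2 ^ d) ^ p.1 := by
        rw [← pow_add, Nat.sub_add_cancel (by omega)]
      rw [e, Pi.one_apply]
      field_simp
    · rw [Set.indicator_of_notMem h]
      simp
  rw [h2]
  exact_mod_cast h1

/-- If the defect is small, then the hubs connect a positive fraction of the deepest subcells. -/
theorem hasComponentOfSize_of_defect_lt {d : ℕ} (hd : 1 ≤ d) {lam n F : ℝ} (hlam : 0 < lam)
    (hn : 0 < n) (hF : 0 < F) (a : Fin d → ℝ) (K : ℕ) {ω : Sample d} {l u : ℝ}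
    (hdef : defect lam F a ((F / n) ^ (1 / (d : ℝ))) K ω < F / 2)
    (hl : l ≤ (2 ^ d) ^ K / 2)
    (hu : (count (cell a ((F / n) ^ (1 / (d : ℝ))) ×ˢ Set.univ) ω : ℝ) ≤ u) :
    HasComponentOfSize (inducedIn lam n ω (cell a ((F / n) ^ (1 / (d : ℝ))))) l u := by
  classical
  set Δ : ℝ := (F / n) ^ (1 / (d : ℝ)) with hΔdef
  have hΔ : 0 ≤ Δ := by positivity
  set G := inducedIn lam n ω (cell a Δ) with hG
  have hcard : ((2 ^ d) ^ K / 2 : ℝ) < (goodIndices lam F a Δ K ω).card := by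
    have h := card_indices_le hF (lam := lam) a Δ K ω
    have h2 : ((2 ^ d) ^ K / F * defect lam F a Δ K ω : ℝ) < (2 ^ d) ^ K / F * (F / 2) := by
      gcongr
    have h3 : ((2 ^ d) ^ K / F * (F / 2) : ℝ) = (2 ^ d) ^ K / 2 := by field_simp
    linarith
  have hvert : ∀ k j, j ∈ indices d k → ω ∉ void (hubs lam F a Δ ⟨k, j⟩) →
      ∃ v : {i : Fin ω.1 | pos ω i ∈ cell a Δ}, ω.2 v.1 ∈ hubs lam F a Δ ⟨k, j⟩ := by
    intro k j hj h
    simp only [void, Set.mem_ofPred_eq, not_forall, not_not] at h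
    obtain ⟨i, hi, hA⟩ := h
    exact ⟨⟨⟨i, hi⟩, subcell_subset_cell a hΔ hj hA.1⟩, hA⟩
  have hgood : ∀ J ∈ goodIndices lam F a Δ K ω, J ∈ indices d K ∧
      ∀ k ≤ K, ω ∉ void (hubs lam F a Δ ⟨k, ancestor K k J⟩) := by
    intro J hJ
    simpa only [goodIndices, Finset.mem_filter] using hJ
  obtain ⟨J₀, hJ₀⟩ : (goodIndices lam F a Δ K ω).Nonempty := by
    rw [← Finset.card_pos]
    have : (0 : ℝ) < (goodIndices lam F a Δ K ω).card := lt_of_le_of_lt (by positivity) hcard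
    exact_mod_cast this
  obtain ⟨root, hroot⟩ : ∃ v : {i : Fin ω.1 | pos ω i ∈ cell a Δ},
      ω.2 v.1 ∈ hubs lam F a Δ ⟨0, 0⟩ := by
    have h := (hgood J₀ hJ₀).2 0 (Nat.zero_le K)
    rw [ancestor_zero (hgood J₀ hJ₀).1] at h
    exact hvert 0 0 (by simp [mem_indices]) h
  -- Descending from the root, a hub is chosen at each depth; it is adjacent to the one chosen just
  -- above.
  have hchain : ∀ J ∈ goodIndices lam F a Δ K ω, ∀ k ≤ K,
      ∃ v : {i : Fin ω.1 | pos ω i ∈ cell a Δ},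
        ω.2 v.1 ∈ hubs lam F a Δ ⟨k, ancestor K k J⟩ ∧ G.Reachable v root := by
    intro J hJ k
    obtain ⟨hJK, hJv⟩ := hgood J hJ
    induction k with
    | zero =>
      intro _
      exact ⟨root, by rwa [ancestor_zero hJK], SimpleGraph.Reachable.refl _⟩
    | succ k ih =>
      intro hk
      obtain ⟨v, hv, hr⟩ := ih (by omega)
      obtain ⟨v', hv'⟩ := hvert (k + 1) (ancestor K (k + 1) J) (ancestor_mem_indices hk hJK)
        (hJv (k + 1) hk)
      refine ⟨v', hv', ?_⟩
      by_cases hvv : v' = v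
      · rwa [hvv]
      · refine SimpleGraph.Reachable.trans (SimpleGraph.Adj.reachable ?_) hr
        rw [ancestor_succ hk J] at hv
        have hadj := adj_of_mem_hubs hd hlam hn hF hv hv'
        exact ⟨fun h => hvv (Subtype.ext h), hadj⟩
  have : Nonempty {i : Fin ω.1 | pos ω i ∈ cell a Δ} := ⟨root⟩
  choose! v hv using fun J (hJ : J ∈ goodIndices lam F a Δ K ω) => hchain J hJ K le_rfl
  refine ⟨G.connectedComponentMk root, hl.trans (hcard.le.trans ?_),
    le_trans (by exact_mod_cast ncard_supp_le_count lam n ω _ _) hu⟩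
  -- The deepest hubs lie in disjoint subcells, so distinct good indices give distinct vertices.
  have h : ((goodIndices lam F a Δ K ω : Finset (Fin d → ℕ)) : Set (Fin d → ℕ)).ncard
      ≤ (G.connectedComponentMk root).supp.ncard := by
    refine Set.ncard_le_ncard_of_injOn v ?_ ?_ (Set.toFinite _)
    · intro J hJ
      exact SimpleGraph.ConnectedComponent.sound (hv J hJ).2
    · intro J hJ J' hJ' heq
      by_contra hne
      have h1 := (hv J hJ).1
      have h2 := (hv J' hJ').1
      rw [ancestor_self] at h1 h2
      rw [← heq] at h2
      exact Set.disjoint_left.1 (disjoint_subcell a hΔ K hne) h1.1 h2.1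
  rw [Set.ncard_coe_finset] at h
  exact_mod_cast h

/-! ### Intensity of hubs -/

/-- The density decreases, so the mass is at least the length times the density at the right end. -/
theorem le_paretoMeasure_real_Ico {r s x : ℝ} (hr : 0 < r) (hs : 1 ≤ s) (hx : 1 ≤ x) :
    r * (s - 1) * s ^ (-(r + 1)) * x ^ (-r) ≤ (paretoMeasure 1 r).real (Set.Ico x (s * x)) := by
  have := isProbabilityMeasure_paretoMeasure (t := 1) (r := r) one_pos hr
  have hx0 : 0 < x := by linarith
  have hs0 : 0 < s := by linarith
  rw [measureReal_def, ← ENNReal.ofReal_le_iff_le_toReal (measure_ne_top _ _), paretoMeasure,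
    withDensity_apply _ measurableSet_Ico]
  have h : ∫⁻ _ in Set.Ico x (s * x), ENNReal.ofReal (r * (s * x) ^ (-(r + 1)))
      ≤ ∫⁻ y in Set.Ico x (s * x), paretoPDF 1 r y := by
    refine setLIntegral_mono' measurableSet_Ico fun y hy => ?_
    rw [paretoPDF_of_le (hx.trans hy.1), Real.one_rpow, mul_one]
    refine ENNReal.ofReal_le_ofReal ?_
    refine mul_le_mul_of_nonneg_left ?_ hr.le
    exact Real.rpow_le_rpow_of_nonpos (by linarith [hy.1]) hy.2.le (by linarith)
  refine le_of_eq_of_le ?_ h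
  rw [setLIntegral_const, Real.volume_Ico, ← ENNReal.ofReal_mul (by positivity)]
  congr 1
  have e : x ^ (-r) = x ^ (-(r + 1)) * x := by
    rw [← Real.rpow_add_one hx0.ne']; congr 1; ring
  rw [Real.mul_rpow hs0.le hx0.le, e]
  ring

/-- The constant in the lower bound for the intensity of hubs in a subcell. -/
def hubRate (d : ℕ) (τ lam : ℝ) : ℝ :=
  (τ - 1) * (Real.sqrt (2 ^ d) - 1) * Real.sqrt (2 ^ d) ^ (-τ) * (2 ^ d / lam) ^ (-(τ - 1) / 2)

theorem hubRate_pos {d : ℕ} (hd : 1 ≤ d) {τ lam : ℝ} (hτ : 1 < τ) (hlam : 0 < lam) :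
    0 < hubRate d τ lam := by
  have h1 : 1 < Real.sqrt (2 ^ d) := by
    rw [Real.lt_sqrt zero_le_one, one_pow]
    exact one_lt_pow₀ one_lt_two (by omega)
  have h2 : 0 < Real.sqrt (2 ^ d) - 1 := by linarith
  have h3 : 0 < τ - 1 := by linarith
  unfold hubRate
  positivity

/-- The subcell has volume `V / n` and the weight range has Pareto mass at least of order `V ^ (-(τ
- 1) / 2)`. The condition `hlarge` keeps hub weights at least 1, inside the Pareto support. -/
theorem le_vertexLaw_real_hubs {d : ℕ} (hd : 1 ≤ d) {τ lam n F : ℝ} (hτ : 1 < τ)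
    (hlam : 0 < lam) (hn : 0 < n) (hF : 0 < F) {a : Fin d → ℝ}
    (hbox : cell a ((F / n) ^ (1 / (d : ℝ))) ⊆ box d) {k : ℕ} {j : Fin d → ℕ}
    (hj : j ∈ indices d k) (hlarge : lam ≤ F / (2 ^ d) ^ k) :
    hubRate d τ lam * (F / (2 ^ d) ^ k) ^ ((3 - τ) / 2)
      ≤ n * (vertexLaw d τ).real (hubs lam F a ((F / n) ^ (1 / (d : ℝ))) ⟨k, j⟩) := by
  have := isProbabilityMeasure_paretoMeasure (t := 1) (r := τ - 1) one_pos (by linarith)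
  set Δ : ℝ := (F / n) ^ (1 / (d : ℝ)) with hΔdef
  have hΔ : 0 ≤ Δ := by positivity
  set V : ℝ := F / (2 ^ d) ^ k with hV
  have hV0 : 0 < V := by positivity
  set s : ℝ := Real.sqrt (2 ^ d) with hs
  have hb : (1 : ℝ) ≤ 2 ^ d := one_le_pow₀ one_le_two
  have hs1 : 1 ≤ s := by rw [hs, Real.one_le_sqrt]; exact hb
  have hw : hubWeight d lam (2 ^ d * V) = s * hubWeight d lam V := by
    rw [hubWeight, hubWeight, hs, ← Real.sqrt_mul (by positivity)]
    congr 1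
    ring
  have hw1 : 1 ≤ hubWeight d lam V := by
    rw [hubWeight, Real.one_le_sqrt, le_div_iff₀ hlam]
    nlinarith
  have hvol : (volume.restrict (box d)).real (subcell a Δ k j) = V / n := by
    rw [measureReal_restrict_apply (measurableSet_subcell a Δ k j),
      Set.inter_eq_left.2 ((subcell_subset_cell a hΔ hj).trans hbox), volume_real_subcell a hΔ,
      div_pow, hΔdef, one_div, Real.rpow_inv_natCast_pow (by positivity) (by omega), hV,
      ← pow_mul, ← pow_mul, mul_comm d k, div_right_comm]
  have hrange := le_paretoMeasure_real_Ico (r := τ - 1) (by linarith) hs1 hw1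
  rw [hubs, vertexLaw, measureReal_prod_prod, hvol]
  simp only
  rw [← hV, hw]
  have hpow : hubWeight d lam V ^ (-(τ - 1))
      = (2 ^ d / lam) ^ (-(τ - 1) / 2) * V ^ (-(τ - 1) / 2) := by
    rw [hubWeight, Real.sqrt_eq_rpow, ← Real.rpow_mul (by positivity),
      ← Real.mul_rpow (by positivity) hV0.le]
    congr 1 <;> ring
  have hVpow : V ^ ((3 - τ) / 2) = V * V ^ (-(τ - 1) / 2) := by
    rw [mul_comm, ← Real.rpow_add_one hV0.ne']
    congr 1
    ring
  calc hubRate d τ lam * V ^ ((3 - τ) / 2)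
      = V * ((τ - 1) * (s - 1) * s ^ (-((τ - 1) + 1)) * hubWeight d lam V ^ (-(τ - 1))) := by
        rw [hubRate, hpow, hVpow, ← hs, sub_add_cancel]
        ring
    _ ≤ V * (paretoMeasure 1 (τ - 1)).real (Set.Ico (hubWeight d lam V) (s * hubWeight d lam V)) :=
        mul_le_mul_of_nonneg_left hrange hV0.le
    _ = _ := by field_simp

/-! ### Large deviations of the defect -/

/-- Use `exp t - 1 ≤ t * exp t`, let half of the void exponent absorb `exp (θ * V)`, and finish with
`1 + x ≤ exp x`. -/
theorem one_add_mul_exp_le {c V al θ y : ℝ} (hV : 0 < V) (hθ : 0 ≤ θ)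
    (hθV : θ * V ≤ c / 2 * V ^ al) (hy : c * V ^ al ≤ y) :
    1 + (Real.exp (θ * V) - 1) * Real.exp (-y)
      ≤ Real.exp (θ * V * Real.exp (-(c / 2 * V ^ al))) := by
  have h1 : Real.exp (θ * V) - 1 ≤ θ * V * Real.exp (θ * V) := by
    have h := Real.add_one_le_exp (-(θ * V))
    have h2 : Real.exp (-(θ * V)) * Real.exp (θ * V) = 1 := by rw [← Real.exp_add]; simp
    have h3 := mul_le_mul_of_nonneg_right h (Real.exp_pos (θ * V)).le
    linarith
  have h2 : Real.exp (θ * V) * Real.exp (-y) ≤ Real.exp (-(c / 2 * V ^ al)) := by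
    rw [← Real.exp_add]
    exact Real.exp_le_exp.2 (by linarith)
  have h3 : (Real.exp (θ * V) - 1) * Real.exp (-y) ≤ θ * V * Real.exp (-(c / 2 * V ^ al)) :=
    calc _ ≤ θ * V * Real.exp (θ * V) * Real.exp (-y) := by gcongr
      _ = θ * V * (Real.exp (θ * V) * Real.exp (-y)) := by ring
      _ ≤ _ := by gcongr
  linarith [Real.add_one_le_exp (θ * V * Real.exp (-(c / 2 * V ^ al)))]

/-- With `exp (-x) ≤ 1 / x` the terms decay geometrically in `K - k`, upwards from the deepest
level, so the bound is uniform in `K` and `F`. -/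
theorem sum_exp_neg_rpow_le {c b al V₀ F : ℝ} (hc : 0 < c) (hb : 1 < b) (hal : 0 < al)
    (hV₀ : 0 < V₀) {K : ℕ} (hK : V₀ * b ^ K ≤ F) :
    ∑ k ∈ Finset.range (K + 1), Real.exp (-(c / 2 * (F / b ^ k) ^ al))
      ≤ 2 / c * V₀ ^ (-al) * (1 - b ^ (-al))⁻¹ := by
  have hb0 : 0 < b := by linarith
  have hq : b ^ (-al) < 1 := Real.rpow_lt_one_of_one_lt_of_neg hb (by linarith)
  have hterm : ∀ k ∈ Finset.range (K + 1), Real.exp (-(c / 2 * (F / b ^ k) ^ al))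
      ≤ 2 / c * V₀ ^ (-al) * (b ^ (-al)) ^ (K + 1 - 1 - k) := by
    intro k hk
    have hkK : k ≤ K := by simpa [Nat.lt_succ_iff] using hk
    have hV : V₀ * b ^ (K - k) ≤ F / b ^ k := by
      rw [le_div_iff₀ (by positivity), mul_assoc, ← pow_add, Nat.sub_add_cancel hkK]
      exact hK
    have hx : 0 < c / 2 * (V₀ * b ^ (K - k)) ^ al := by positivity
    calc Real.exp (-(c / 2 * (F / b ^ k) ^ al))
        ≤ Real.exp (-(c / 2 * (V₀ * b ^ (K - k)) ^ al)) := by gcongr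
      _ ≤ (c / 2 * (V₀ * b ^ (K - k)) ^ al)⁻¹ := by
          rw [Real.exp_neg]
          exact inv_anti₀ hx (by linarith [Real.add_one_le_exp (c / 2 * (V₀ * b ^ (K - k)) ^ al)])
      _ = _ := by
          rw [Real.mul_rpow hV₀.le (by positivity), mul_inv, mul_inv, ← Real.rpow_neg hV₀.le,
            ← Real.rpow_neg (by positivity), inv_div, Nat.add_sub_cancel, ← mul_assoc,
            ← Real.rpow_natCast b, ← Real.rpow_natCast (b ^ (-al)), ← Real.rpow_mul hb0.le,
            ← Real.rpow_mul hb0.le, mul_comm (-al)]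
  refine (Finset.sum_le_sum hterm).trans ?_
  rw [← Finset.mul_sum, Finset.sum_range_reflect (fun k => (b ^ (-al)) ^ k) (K + 1)]
  gcongr
  have hq0 : 0 ≤ b ^ (-al) := by positivity
  have hgeo := (summable_geometric_of_lt_one hq0 hq).sum_le_tsum (Finset.range (K + 1))
    fun i _ => by positivity
  rwa [tsum_geometric_of_lt_one hq0 hq] at hgeo

theorem exp_mul_defect {d : ℕ} (lam F : ℝ) (hF : 0 ≤ F) (a : Fin d → ℝ) (Δ : ℝ) (K : ℕ) {θ : ℝ}
    (hθ : 0 ≤ θ) (ω : Sample d) :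
    ENNReal.ofReal (Real.exp (θ * defect lam F a Δ K ω))
      = ∏ p ∈ tree d K, (1 + ENNReal.ofReal (Real.exp (θ * (F / (2 ^ d) ^ p.1)) - 1)
          * (void (hubs lam F a Δ p)).indicator 1 ω) := by
  rw [defect, Finset.mul_sum, Real.exp_sum, ENNReal.ofReal_prod_of_nonneg
    fun p _ => (Real.exp_pos _).le]
  refine Finset.prod_congr rfl fun p _ => ?_
  by_cases h : ω ∈ void (hubs lam F a Δ p)
  · rw [Set.indicator_of_mem h, Set.indicator_of_mem h, Pi.one_apply, Pi.one_apply, mul_one,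
      mul_one, ← ENNReal.ofReal_one, ← ENNReal.ofReal_add zero_le_one, add_sub_cancel]
    rw [sub_nonneg, Real.one_le_exp_iff]
    positivity
  · rw [Set.indicator_of_notMem h, Set.indicator_of_notMem h]
    simp

/-- A large deviation bound for the defect. -/
theorem law_le_defect_le {d : ℕ} (hd : 1 ≤ d) {τ lam n F V₀ : ℝ} (hτ₂ : 2 < τ) (hτ₃ : τ < 3)
    (hlam : 0 < lam) (hn : 0 < n) (hV₀ : 0 < V₀) (hV₀lam : lam ≤ V₀)
    (hV₀large : 2 / hubRate d τ lam * V₀ ^ (-((3 - τ) / 2))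
      * (1 - ((2 : ℝ) ^ d) ^ (-((3 - τ) / 2)))⁻¹ ≤ 1 / 4)
    {a : Fin d → ℝ} (hbox : cell a ((F / n) ^ (1 / (d : ℝ))) ⊆ box d)
    {K : ℕ} (hK : V₀ * (2 ^ d) ^ K ≤ F) :
    law d τ n {ω | F / 2 ≤ defect lam F a ((F / n) ^ (1 / (d : ℝ))) K ω}
      ≤ ENNReal.ofReal (Real.exp (-(hubRate d τ lam / 8 * F ^ ((3 - τ) / 2)))) := by
  have := isProbabilityMeasure_vertexLaw d (τ := τ) (by linarith)
  set c := hubRate d τ lam with hc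
  have hc0 : 0 < c := hubRate_pos hd (by linarith) hlam
  set al := (3 - τ) / 2 with hal
  have hal0 : 0 < al := by rw [hal]; linarith
  have hal1 : al < 1 := by rw [hal]; linarith
  set Δ : ℝ := (F / n) ^ (1 / (d : ℝ)) with hΔdef
  have hF : 0 < F := lt_of_lt_of_le (by positivity) hK
  have hΔ : 0 ≤ Δ := by positivity
  set b : ℝ := 2 ^ d with hb
  have hb1 : 1 < b := one_lt_pow₀ one_lt_two (by omega)
  -- The largest tilt with `θ * V ≤ c / 2 * V ^ al` for all `V ≤ F`: as `al < 1`, the tightest case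
  -- is `V = F`.
  set θ : ℝ := c / 2 * F ^ (al - 1) with hθ
  have hθ0 : 0 < θ := by positivity
  have hθF : θ * F = c / 2 * F ^ al := by
    rw [hθ, mul_assoc, ← Real.rpow_add_one hF.ne', sub_add_cancel]
  have hmem : ∀ p ∈ tree d K, p.1 ≤ K ∧ p.2 ∈ indices d p.1 := by
    intro p hp
    simp only [tree, Finset.mem_sigma, Finset.mem_range] at hp
    exact ⟨by omega, hp.2⟩
  have hint : ∫⁻ ω, ENNReal.ofReal (Real.exp (θ * defect lam F a Δ K ω)) ∂(law d τ n)
      ≤ ENNReal.ofReal (Real.exp (θ * F / 4)) := by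
    simp_rw [exp_mul_defect lam F hF.le a Δ K hθ0.le]
    rw [law, lintegral_prod_one_add_void _ _ _ _ (fun p _ => measurableSet_hubs lam F a Δ p)
      ((pairwise_disjoint_hubs hlam hF.le a hΔ).set_pairwise _)]
    have hfactor : ∀ p ∈ tree d K, 1 + ENNReal.ofReal (Real.exp (θ * (F / b ^ p.1)) - 1)
        * ENNReal.ofReal (Real.exp (-(n.toNNReal * (vertexLaw d τ).real (hubs lam F a Δ p))))
        ≤ ENNReal.ofReal (Real.exp (θ * (F / b ^ p.1)
          * Real.exp (-(c / 2 * (F / b ^ p.1) ^ al)))) := by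
      intro p hp
      obtain ⟨hpK, hpj⟩ := hmem p hp
      have hV : 0 < F / b ^ p.1 := by positivity
      have hVF : F / b ^ p.1 ≤ F := div_le_self hF.le (one_le_pow₀ hb1.le)
      have hVV : V₀ ≤ F / b ^ p.1 := by
        rw [le_div_iff₀ (by positivity)]
        refine le_trans ?_ hK
        gcongr
        exact hb1.le
      have hnn : 0 ≤ Real.exp (θ * (F / b ^ p.1)) - 1 := by
        rw [sub_nonneg, Real.one_le_exp_iff]
        positivity
      rw [← ENNReal.ofReal_mul hnn, ← ENNReal.ofReal_one,
        ← ENNReal.ofReal_add zero_le_one (by positivity)]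
      refine ENNReal.ofReal_le_ofReal (one_add_mul_exp_le hV hθ0.le ?_ ?_)
      · rw [hθ, mul_assoc]
        refine mul_le_mul_of_nonneg_left ?_ (by positivity)
        calc F ^ (al - 1) * (F / b ^ p.1) ≤ (F / b ^ p.1) ^ (al - 1) * (F / b ^ p.1) := by
              refine mul_le_mul_of_nonneg_right ?_ hV.le
              exact Real.rpow_le_rpow_of_nonpos hV hVF (by linarith)
          _ = (F / b ^ p.1) ^ al := by rw [← Real.rpow_add_one hV.ne', sub_add_cancel]
      · rw [Real.coe_toNNReal n hn.le]
        exact le_vertexLaw_real_hubs hd (by linarith) hlam hn hF hbox hpj (hV₀lam.trans hVV)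
    refine (Finset.prod_le_prod' hfactor).trans ?_
    rw [← ENNReal.ofReal_prod_of_nonneg fun p _ => (Real.exp_pos _).le, ← Real.exp_sum]
    refine ENNReal.ofReal_le_ofReal (Real.exp_le_exp.2 ?_)
    rw [tree, Finset.sum_sigma]
    -- The subcells of each level have total volume `F`.
    have hlevel : ∀ k ∈ Finset.range (K + 1), ∑ _j ∈ indices d k, θ * (F / b ^ k)
        * Real.exp (-(c / 2 * (F / b ^ k) ^ al))
        = θ * F * Real.exp (-(c / 2 * (F / b ^ k) ^ al)) := by
      intro k _
      rw [Finset.sum_const, card_indices, nsmul_eq_mul, Nat.cast_pow, Nat.cast_pow,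
        Nat.cast_ofNat, ← hb]
      field_simp
    rw [Finset.sum_congr rfl hlevel, ← Finset.mul_sum]
    have h := (sum_exp_neg_rpow_le hc0 hb1 hal0 hV₀ hK).trans hV₀large
    have := mul_le_mul_of_nonneg_left h (by positivity : 0 ≤ θ * F)
    linarith
  have hmeas : Measurable fun ω : Sample d =>
      ENNReal.ofReal (Real.exp (θ * defect lam F a Δ K ω)) := by
    refine ((Measurable.const_mul ?_ θ).exp).ennreal_ofReal
    unfold defect
    exact Finset.measurable_fun_sum _ fun p _ => (measurable_one.indicator
      (measurableSet_void (measurableSet_hubs lam F a Δ p))).const_mul _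
  have hsub : {ω : Sample d | F / 2 ≤ defect lam F a Δ K ω} ⊆
      {ω | ENNReal.ofReal (Real.exp (θ * F / 2))
        ≤ ENNReal.ofReal (Real.exp (θ * defect lam F a Δ K ω))} := by
    intro ω hω
    refine ENNReal.ofReal_le_ofReal (Real.exp_le_exp.2 ?_)
    have := mul_le_mul_of_nonneg_left (show F / 2 ≤ defect lam F a Δ K ω from hω) hθ0.le
    linarith
  have hm := (mul_meas_ge_le_lintegral (μ := law d τ n) hmeas
    (ENNReal.ofReal (Real.exp (θ * F / 2)))).trans hint
  have he0 : ENNReal.ofReal (Real.exp (θ * F / 2)) ≠ 0 := by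
    simpa using Real.exp_pos (θ * F / 2)
  -- Markov's inequality leaves `exp (-(θ * F / 4))`, and `θ * F / 4 = c / 8 * F ^ al`.
  calc law d τ n {ω | F / 2 ≤ defect lam F a Δ K ω}
      ≤ _ := measure_mono hsub
    _ ≤ ENNReal.ofReal (Real.exp (θ * F / 4)) / ENNReal.ofReal (Real.exp (θ * F / 2)) := by
        rw [ENNReal.le_div_iff_mul_le (Or.inl he0) (Or.inl ENNReal.ofReal_ne_top), mul_comm]
        exact hm
    _ = _ := by
        rw [← ENNReal.ofReal_div_of_pos (Real.exp_pos _), ← Real.exp_sub]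
        congr 2
        rw [hθF]
        ring

/-! ### Choice of constants and conclusion -/

theorem mul_vertexLaw_real_cell {d : ℕ} (hd : 1 ≤ d) {τ n F : ℝ} (hτ : 1 < τ)
    (hn : 0 < n) (hF : 0 < F) {a : Fin d → ℝ}
    (hbox : cell a ((F / n) ^ (1 / (d : ℝ))) ⊆ box d) :
    n * (vertexLaw d τ).real (cell a ((F / n) ^ (1 / (d : ℝ))) ×ˢ Set.univ) = F := by
  have := isProbabilityMeasure_paretoMeasure (t := 1) (r := τ - 1) one_pos (by linarith)
  set Δ : ℝ := (F / n) ^ (1 / (d : ℝ)) with hΔdef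
  have hΔ : 0 ≤ Δ := by positivity
  have hvol : (volume.restrict (box d)).real (cell a Δ) = F / n := by
    rw [measureReal_restrict_apply (by exact measurableSet_Icc), Set.inter_eq_left.2 hbox, measureReal_def,
      cell, Real.volume_Icc_pi_toReal fun i => by simpa using hΔ]
    simp only [add_sub_cancel_left, Finset.prod_const, Finset.card_univ, Fintype.card_fin]
    rw [hΔdef, one_div, Real.rpow_inv_natCast_pow (by positivity) (by omega)]
  rw [vertexLaw, measureReal_prod_prod, hvol, probReal_univ]
  field_simp

/-- A union bound by subadditivity alone, so the component event need not be shown measurable. -/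
theorem one_sub_le_measureReal {Ω : Type*} [MeasurableSpace Ω] (P : Measure Ω)
    [IsProbabilityMeasure P] {B₁ B₂ E : Set Ω} {x y z : ℝ} (hx : 0 ≤ x) (hy : 0 ≤ y)
    (h₁ : P B₁ ≤ ENNReal.ofReal x) (h₂ : P B₂ ≤ ENNReal.ofReal y) (hz : x + y ≤ z)
    (hE : ∀ ω, ω ∉ B₁ → ω ∉ B₂ → ω ∈ E) : 1 - z ≤ P.real E := by
  have hcover : (Set.univ : Set Ω) ⊆ E ∪ (B₁ ∪ B₂) := by
    intro ω _
    by_contra h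
    simp only [Set.mem_union, not_or] at h
    exact h.1 (hE ω h.2.1 h.2.2)
  have hu : 1 ≤ P.real E + (P.real B₁ + P.real B₂) :=
    calc 1 = P.real Set.univ := probReal_univ.symm
      _ ≤ P.real (E ∪ (B₁ ∪ B₂)) := measureReal_mono hcover
      _ ≤ P.real E + P.real (B₁ ∪ B₂) := measureReal_union_le _ _
      _ ≤ _ := by gcongr; exact measureReal_union_le _ _
  have h1 : P.real B₁ ≤ x := ENNReal.toReal_le_of_le_ofReal hx h₁
  have h2 : P.real B₂ ≤ y := ENNReal.toReal_le_of_le_ofReal hy h₂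
  linarith

open Filter Topology in
-- `V₀` is the volume scale at which subdivision stops. The last condition later absorbs the factor
-- 2 from adding two failure probabilities.
theorem exists_base_volume {al b c c' lam : ℝ} (hal : 0 < al) (hc' : 0 < c') :
    ∃ V₀ : ℝ, 1 ≤ V₀ ∧ lam ≤ V₀ ∧ 2 / c * V₀ ^ (-al) * (1 - b ^ (-al))⁻¹ ≤ 1 / 4 ∧
      2 ≤ Real.exp (c' * V₀ ^ al) := by
  have h1 : Tendsto (fun V : ℝ => 2 / c * V ^ (-al) * (1 - b ^ (-al))⁻¹) atTop (𝓝 0) := by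
    have := ((tendsto_rpow_neg_atTop hal).const_mul (2 / c)).mul_const (1 - b ^ (-al))⁻¹
    simpa using this
  have h2 : Tendsto (fun V : ℝ => Real.exp (c' * V ^ al)) atTop atTop :=
    Real.tendsto_exp_atTop.comp ((tendsto_rpow_atTop hal).const_mul_atTop hc')
  obtain ⟨V₀, h⟩ := ((eventually_ge_atTop 1).and ((eventually_ge_atTop lam).and
    ((h1.eventually_le_const (by norm_num : (0 : ℝ) < 1 / 4)).and
      (h2.eventually_ge_atTop 2)))).exists
  exact ⟨V₀, h⟩

end GIRG
end

theorem mainTheorem2 (d : ℕ) (hd : 1 ≤ d) (τ : ℝ) (hτ₂ : 2 < τ) (hτ₃ : τ < 3)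
    (lam : ℝ) (hlam : 0 < lam) (m₀ : ℝ) (hm₀ : 0 < m₀) :
    ∃ c C κ : ℝ, 0 < c ∧ 0 < C ∧ 0 < κ ∧
      ∀ (f : ℝ → ℝ) (n : ℝ), 0 < n → m₀ ≤ f n →
        ∀ a : Fin d → ℝ, GIRG.cell a ((f n / n) ^ (1 / (d : ℝ))) ⊆ GIRG.box d →
          1 - Real.exp (-(κ * f n ^ ((3 - τ) / 2))) ≤
            (GIRG.law d τ n).real
              {ω | GIRG.HasComponentOfSize
                (GIRG.inducedIn lam n ω (GIRG.cell a ((f n / n) ^ (1 / (d : ℝ)))))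
                (c * f n) (C * f n)} := by
  have hτ₁ : 1 < τ := by linarith
  have := GIRG.isProbabilityMeasure_vertexLaw d hτ₁
  have hlaw := GIRG.isProbabilityMeasure_law d hτ₁
  set al := (3 - τ) / 2 with hal
  have hal0 : 0 < al := by rw [hal]; linarith
  have hal1 : al ≤ 1 := by rw [hal]; linarith
  have hrate := GIRG.hubRate_pos hd hτ₁ hlam
  set A : ℝ := min (GIRG.hubRate d τ lam / 8) 1 with hA
  have hA0 : 0 < A := by rw [hA]; positivity
  obtain ⟨V₀, hV1, hVlam, hVlarge, hVexp⟩ := GIRG.exists_base_volume (al := al)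
    (b := (2 : ℝ) ^ d) (c := GIRG.hubRate d τ lam) (c' := A / 2) (lam := lam) hal0 (by positivity)
  have hV0 : 0 < V₀ := by linarith
  have hb1 : (1 : ℝ) < 2 ^ d := one_lt_pow₀ one_lt_two (by omega)
  -- `p` bounds the probability that the cell is empty, for small `f n`.
  set p : ℝ := Real.exp (-m₀) with hp
  have hp0 : 0 < p := Real.exp_pos _
  have hp1 : p < 1 := (Real.exp_lt_exp.2 (by linarith : -m₀ < 0)).trans_eq Real.exp_zero
  -- For small `F` the cell is empty with probability at most `p`. `L` makes the Chernoff error at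
  -- most `(1 - p) / 2`, and `M` turns the sum `(1 + p) / 2 < 1` into an exponential.
  set L : ℝ := -Real.log ((1 - p) / 2) with hL
  have hL0 : 0 < L := by
    have := Real.log_neg (show 0 < (1 - p) / 2 by linarith) (by linarith)
    rw [hL]; linarith
  have hLexp : Real.exp (-L) = (1 - p) / 2 := by rw [hL, neg_neg, Real.exp_log (by linarith)]
  set M : ℝ := -Real.log ((1 + p) / 2) with hM
  have hM0 : 0 < M := by
    have := Real.log_neg (show 0 < (1 + p) / 2 by linarith) (by linarith)
    rw [hM]; linarith
  have hMexp : Real.exp (-M) = (1 + p) / 2 := by rw [hM, neg_neg, Real.exp_log (by linarith)]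
  refine ⟨1 / (2 * 2 ^ d * V₀), 3 + L / m₀, min (A / 2) (M / V₀ ^ al), by positivity,
    by positivity, by positivity, ?_⟩
  intro f n hn hf a hbox
  generalize f n = F at hf hbox ⊢
  have hF : 0 < F := by linarith
  have hLF : L ≤ L / m₀ * F := by
    rw [div_mul_eq_mul_div, le_div_iff₀ hm₀]
    gcongr
  have hmean := GIRG.mul_vertexLaw_real_cell hd hτ₁ hn hF hbox
  set Q := GIRG.cell a ((F / n) ^ (1 / (d : ℝ))) with hQ
  have hQm : MeasurableSet (Q ×ˢ (Set.univ : Set ℝ)) := measurableSet_Icc.prod .univ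
  have hcount := GIRG.measure_lt_count_le (GIRG.vertexLaw d τ) n.toNNReal hQm ((3 + L / m₀) * F)
  rw [Real.coe_toNNReal n hn.le, hmean] at hcount
  have hκ0 : 0 < F ^ al := by positivity
  rcases lt_or_ge F V₀ with hFV | hFV
  · have hvoid := GIRG.measure_void (GIRG.vertexLaw d τ) n.toNNReal hQm
    rw [Real.coe_toNNReal n hn.le, hmean] at hvoid
    refine GIRG.one_sub_le_measureReal (GIRG.law d τ n) (Real.exp_pos _).le (Real.exp_pos _).le
      hvoid.le hcount ?_ ?_
    · have h1 : Real.exp (-F) ≤ p := Real.exp_le_exp.2 (by linarith)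
      have h2 : Real.exp (2 * F - (3 + L / m₀) * F) ≤ (1 - p) / 2 := by
        rw [← hLexp]
        exact Real.exp_le_exp.2 (by linarith)
      have h3 : (1 + p) / 2 ≤ Real.exp (-(min (A / 2) (M / V₀ ^ al) * F ^ al)) := by
        rw [← hMexp]
        refine Real.exp_le_exp.2 (neg_le_neg ?_)
        calc min (A / 2) (M / V₀ ^ al) * F ^ al ≤ M / V₀ ^ al * V₀ ^ al := by
              gcongr
              exact min_le_right _ _
          _ = M := by field_simp
      linarith
    · intro ω h1 h2
      refine GIRG.hasComponentOfSize_of_notMem_void lam n h1 ?_ (not_lt.1 h2)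
      -- As `F < V₀`, the required size `c * F` is at most 1.
      rw [one_div_mul_eq_div, div_le_one (by positivity)]
      nlinarith
  -- `K` is the last depth with subcell volume at least `V₀`; thus `F < V₀ * (2 ^ d) ^ (K + 1)`,
  -- which gives `c * F ≤ (2 ^ d) ^ K / 2`.
  · obtain ⟨K, hK1, hK2⟩ := exists_nat_pow_near ((one_le_div hV0).2 hFV) hb1
    rw [le_div_iff₀ hV0, mul_comm] at hK1
    rw [div_lt_iff₀ hV0] at hK2
    have hdef := GIRG.law_le_defect_le hd hτ₂ hτ₃ hlam hn hV0 hVlam hVlarge hbox hK1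
    refine GIRG.one_sub_le_measureReal (GIRG.law d τ n) (Real.exp_pos _).le (Real.exp_pos _).le
      hdef hcount ?_ ?_
    · have hF1 : 1 ≤ F := hV1.trans hFV
      have h1 : Real.exp (-(GIRG.hubRate d τ lam / 8 * F ^ al)) ≤ Real.exp (-(A * F ^ al)) := by
        gcongr
        exact min_le_left _ _
      have h2 : Real.exp (2 * F - (3 + L / m₀) * F) ≤ Real.exp (-(A * F ^ al)) := by
        refine Real.exp_le_exp.2 ?_
        have h3 : A * F ^ al ≤ 1 * F ^ (1 : ℝ) := by
          gcongr
          exact min_le_right _ _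
        rw [Real.rpow_one] at h3
        linarith
      have h3 : 2 * Real.exp (-(A * F ^ al)) ≤ Real.exp (-(A / 2 * F ^ al)) := by
        have h4 : (2 : ℝ) ≤ Real.exp (A / 2 * F ^ al) := by
          refine hVexp.trans (Real.exp_le_exp.2 ?_)
          gcongr
        calc 2 * Real.exp (-(A * F ^ al))
            ≤ Real.exp (A / 2 * F ^ al) * Real.exp (-(A * F ^ al)) := by gcongr
          _ = Real.exp (-(A / 2 * F ^ al)) := by rw [← Real.exp_add]; congr 1; ring
      have h5 : Real.exp (-(A / 2 * F ^ al))
          ≤ Real.exp (-(min (A / 2) (M / V₀ ^ al) * F ^ al)) := by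
        gcongr
        exact min_le_left _ _
      linarith
    · intro ω h1 h2
      refine GIRG.hasComponentOfSize_of_defect_lt hd hlam hn hF a K (not_le.1 h1) ?_ (not_lt.1 h2)
      rw [one_div_mul_eq_div, div_le_div_iff₀ (by positivity) two_pos]
      rw [pow_succ] at hK2
      nlinarith
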